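/- Let $\mathbb C^{+2} := \{(z_1,z_2)\in\mathbb C^2 : \operatorname{Im} z_1>0,\ \operatorname{Im} z_2>0\}$, and for $(z_1,z_2)\in\mathbb C^{+2}$ and $(t_1,t_2)\in\mathbb R^2$ put $$K\big((z_1,z_2),(t_1,t_2)\big) := -\frac{i}{2}\left(\frac{1}{t_1-z_1}-\frac{1}{t_1+i}\right)\left(\frac{1}{t_2-z_2}-\frac{1}{t_2+i}\right) - \frac{i}{(1+t_1^2)(1+t_2^2)}.$$ **Theorem.** A function $q\colon \mathbb C^{+2}\to\mathbb C$ is holomorphic with non-negative imaginary part (i.e. a Herglotz-Nevanlinna function in two variables) if and only if there exist $a\in\mathbb R$, $b_1,b_2\ge 0$ and a positive Borel measure $\mu$ on $\mathbb R^2$ satisfying the growth condition $$\iint_{\mathbb R^2}\frac{1}{(1+t_1^2)(1+t_2^2)}\,d\mu(t_1,t_2)<\infty$$ and the Nevanlinna condition $$\iint_{\mathbb R^2}\operatorname{Re}\left[\left(\frac{1}{t_1-\overline{z_1}}-\frac{1}{t_1+i}\right)\left(\frac{1}{t_2-z_2}-\frac{1}{t_2-i}\right)\right]d\mu(t_1,t_2)=0\qquad\text{for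 all }(z_1,z_2)\in\mathbb C^{+2},$$ such that $$q(z_1,z_2)=a+b_1z_1+b_2z_2+\frac{1}{\pi^2}\iint_{\mathbb R^2}K\big((z_1,z_2),(t_1,t_2)\big)\,d\mu(t_1,t_2)\qquad\text{for all }(z_1,z_2)\in\mathbb C^{+2}.$$ -/

import Mathlib

open MeasureTheory

/-- The poly-upper half-plane `ℂ⁺²` in `ℂ²`. -/
def polyUpperHalfPlane : Set (ℂ × ℂ) :=
  {z | 0 < z.1.im ∧ 0 < z.2.im}

/-- Herglotz-Nevanlinna functions in two variables: holomorphic on `ℂ⁺²` with non-negative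
imaginary part there. Values of `q` outside `ℂ⁺²` are irrelevant. -/
def IsHerglotzNevanlinna (q : ℂ × ℂ → ℂ) : Prop :=
  DifferentiableOn ℂ q polyUpperHalfPlane ∧ ∀ z ∈ polyUpperHalfPlane, 0 ≤ (q z).im

/-- The kernel `K((z₁,z₂),(t₁,t₂))`. -/
noncomputable def kernelK (z : ℂ × ℂ) (t : ℝ × ℝ) : ℂ :=
  -(Complex.I / 2) *
      (1 / ((t.1 : ℂ) - z.1) - 1 / ((t.1 : ℂ) + Complex.I)) *
      (1 / ((t.2 : ℂ) - z.2) - 1 / ((t.2 : ℂ) + Complex.I))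
    - Complex.I / ((1 + (t.1 : ℂ) ^ 2) * (1 + (t.2 : ℂ) ^ 2))

/-- The growth condition on a positive Borel measure on `ℝ²`, with the integral of the
non-negative integrand taken in `[0, ∞]`. -/
def GrowthCondition (μ : Measure (ℝ × ℝ)) : Prop :=
  ∫⁻ t : ℝ × ℝ, ENNReal.ofReal (1 / ((1 + t.1 ^ 2) * (1 + t.2 ^ 2))) ∂μ < ⊤

/-- The Nevanlinna condition on a positive Borel measure on `ℝ²`. The integrand is bounded by a
constant (depending on `z`) times `1 / ((1 + t₁²) (1 + t₂²))`, so that it is integrable for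
every measure that satisfies `GrowthCondition`. -/
def NevanlinnaCondition (μ : Measure (ℝ × ℝ)) : Prop :=
  ∀ z ∈ polyUpperHalfPlane,
    ∫ t : ℝ × ℝ,
      ((1 / ((t.1 : ℂ) - (starRingEnd ℂ) z.1) - 1 / ((t.1 : ℂ) + Complex.I)) *
        (1 / ((t.2 : ℂ) - z.2) - 1 / ((t.2 : ℂ) - Complex.I))).re ∂μ = 0

open Complex Metric Set Filter Topology Real ComplexConjugate

/-! The Cayley transform turns `q` into a function `F = -i q` of non-negative real part on the
bidisc, where the claim becomes a Herglotz formula. For `G` holomorphic near the closed bidisc,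
Cauchy's formula recovers `G` from `Re G` on the torus, with kernel `2 S₁ S₂ - 1` for the Szegő
kernels `S₁`, `S₂` (`integral_torus_re_mul_szego`). Moreover `Re G` is the sum of a holomorphic and
an antiholomorphic function, so its Fourier coefficients of mixed sign vanish
(`integral_torus_re_mul_shiftedSzego`). Both facts survive the weak limit of the dilates of `F`
(`exists_torus_measure`).

The real plane is the torus without the two circles where a coordinate equals `1`, i.e. where a real
variable is infinite. The vanishing of mixed coefficients leaves on each circle only a multiple of
arc length, and no atom at their intersection; these pieces yield `b₁ z₁` and `b₂ z₂`
(`integral_szego_eq`). The rest of the measure, weighted by `π² (1 + t₁²) (1 + t₂²)`, is `μ`.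

Conversely, the real part of `2 S₁ S₂ - 1` differs from a product of two Poisson kernels, which is
non-negative, by half the weighted Nevanlinna integrand. The Nevanlinna condition removes this
difference on integration (`re_torusTransform_nonneg`). -/

/-! ### Arc length and Szegő kernels on the circle -/

/-- The unit circle in the complex plane. -/
abbrev UnitCircle : Type := sphere (0 : ℂ) 1

/-- The parametrization of the unit circle by the angle. -/
noncomputable def UnitCircle.exp (θ : ℝ) : UnitCircle :=
  ⟨circleMap 0 1 θ, circleMap_mem_sphere 0 zero_le_one θ⟩

theorem UnitCircle.continuous_exp : Continuous UnitCircle.exp :=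
  (continuous_circleMap 0 1).subtype_mk _

/-- The normalized arc length on the unit circle. -/
noncomputable def arcMeasure : Measure UnitCircle :=
  ENNReal.ofReal (2 * π)⁻¹ • (volume.restrict (Ioc 0 (2 * π))).map UnitCircle.exp

instance arcMeasure.instIsProbabilityMeasure : IsProbabilityMeasure arcMeasure := by
  constructor
  rw [arcMeasure, Measure.smul_apply, Measure.map_apply UnitCircle.continuous_exp.measurable .univ]
  simp only [preimage_univ, Measure.restrict_apply_univ, Real.volume_Ioc, sub_zero, smul_eq_mul]
  rw [← ENNReal.ofReal_mul (by positivity), inv_mul_cancel₀ (by positivity), ENNReal.ofReal_one]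

theorem integral_arcMeasure {g : ℂ → ℂ} (hg : Continuous fun s : UnitCircle ↦ g s) :
    ∫ s : UnitCircle, g s ∂arcMeasure = circleAverage g 0 1 := by
  rw [arcMeasure, integral_smul_measure,
    integral_map UnitCircle.continuous_exp.aemeasurable hg.aestronglyMeasurable,
    circleAverage_def, intervalIntegral.integral_of_le (by positivity),
    ENNReal.toReal_ofReal (by positivity)]
  rfl

@[simp] theorem UnitCircle.norm_coe (s : UnitCircle) : ‖(s : ℂ)‖ = 1 := norm_eq_of_mem_sphere s

theorem UnitCircle.coe_mem_closedBall (s : UnitCircle) : (s : ℂ) ∈ closedBall (0 : ℂ) 1 := by simp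

theorem one_sub_mul_ne_zero {w s : ℂ} (hw : w ∈ ball (0 : ℂ) 1) (hs : s ∈ closedBall (0 : ℂ) 1) :
    1 - w * s ≠ 0 := by
  intro h
  have h1 : ‖w * s‖ = 1 := by rw [← sub_eq_zero.1 h, norm_one]
  rw [mem_ball_zero_iff] at hw
  rw [mem_closedBall_zero_iff] at hs
  rw [norm_mul] at h1
  nlinarith [norm_nonneg w, norm_nonneg s]

theorem conj_mem_unitBall {w : ℂ} (hw : w ∈ ball (0 : ℂ) 1) : conj w ∈ ball (0 : ℂ) 1 := by
  simpa using hw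

theorem UnitCircle.one_sub_mul_conj_ne_zero {w : ℂ} (hw : w ∈ ball (0 : ℂ) 1) (s : UnitCircle) :
    1 - w * conj (s : ℂ) ≠ 0 :=
  one_sub_mul_ne_zero hw (by simp)

theorem UnitCircle.one_sub_conj_mul_ne_zero {w : ℂ} (hw : w ∈ ball (0 : ℂ) 1) (s : UnitCircle) :
    1 - conj w * (s : ℂ) ≠ 0 :=
  one_sub_mul_ne_zero (conj_mem_unitBall hw) (by simp)

/-- The Szegő kernel of the unit disc. -/
noncomputable def szego (w : ℂ) (s : UnitCircle) : ℂ := (1 - w * conj (s : ℂ))⁻¹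

/-- The conjugate Szegő kernel multiplied by the coordinate; it vanishes at the origin. -/
noncomputable def shiftedSzego (w : ℂ) (s : UnitCircle) : ℂ := s * (1 - conj w * s)⁻¹

theorem continuous_szego {w : ℂ} (hw : w ∈ ball (0 : ℂ) 1) : Continuous (szego w) := by
  unfold szego
  have := UnitCircle.one_sub_mul_conj_ne_zero hw
  fun_prop (disch := assumption)

theorem continuous_shiftedSzego {w : ℂ} (hw : w ∈ ball (0 : ℂ) 1) :
    Continuous (shiftedSzego w) := by
  unfold shiftedSzego
  have := UnitCircle.one_sub_conj_mul_ne_zero hw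
  fun_prop (disch := assumption)

@[simp] theorem szego_zero (s : UnitCircle) : szego 0 s = 1 := by simp [szego]

theorem integral_mul_szego {g : ℂ → ℂ} (hg : ∀ x ∈ closedBall (0 : ℂ) 1, DifferentiableAt ℂ g x)
    {w : ℂ} (hw : w ∈ ball (0 : ℂ) 1) :
    ∫ s : UnitCircle, g s * szego w s ∂arcMeasure = g w := by
  have hgc : Continuous fun s : UnitCircle ↦ g s := continuous_iff_continuousAt.2 fun s ↦
    (hg s s.coe_mem_closedBall).continuousAt.comp continuous_subtype_val.continuousAt
  have hd : DiffContOnCl ℂ g (ball 0 |1|) := by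
    have h : DifferentiableOn ℂ g (closure (ball (0 : ℂ) |1|)) := by
      rw [abs_one, closure_ball _ one_ne_zero]
      exact fun x hx ↦ (hg x hx).differentiableWithinAt
    exact h.diffContOnCl
  have hne : ∀ s : UnitCircle, (s : ℂ) - w ≠ 0 := by
    intro s h
    rw [mem_ball_zero_iff, ← sub_eq_zero.1 h] at hw
    exact (s.norm_coe ▸ hw).ne rfl
  -- On the circle `conj s = 1 / s`, which turns the Szegő kernel into the Cauchy kernel `s / (s -
  -- w)`.
  have hk : ∀ s : UnitCircle, g s * szego w s = (((s : ℂ) - 0) / ((s : ℂ) - w)) • g s := by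
    intro s
    have h1 := UnitCircle.one_sub_mul_conj_ne_zero hw s
    have h2 : (s : ℂ) * conj (s : ℂ) = 1 := by simp [Complex.mul_conj']
    have h3 : szego w s = ((s : ℂ) / ((s : ℂ) - w)) := by
      rw [szego, inv_eq_one_div, div_eq_div_iff h1 (hne s)]
      linear_combination w * h2
    rw [h3, sub_zero, smul_eq_mul, mul_comm]
  rw [← hd.circleAverage_smul_div (w := w) (by simpa using hw)]
  rw [← integral_arcMeasure]
  · exact integral_congr_ae (.of_forall hk)
  · simp only [sub_zero, smul_eq_mul]
    exact (continuous_subtype_val.div₀ (continuous_subtype_val.sub continuous_const) hne).mul hgc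

theorem integral_eq_zero_of_vanishing {g : ℂ → ℂ}
    (hg : ∀ x ∈ closedBall (0 : ℂ) 1, DifferentiableAt ℂ g x) (h0 : g 0 = 0) :
    ∫ s : UnitCircle, g s ∂arcMeasure = 0 := by
  simpa [h0] using integral_mul_szego hg (w := 0) (by simp)

theorem Continuous.integrable_of_compactSpace {X E : Type*} [TopologicalSpace X] [CompactSpace X]
    [MeasurableSpace X] [OpensMeasurableSpace X] [NormedAddCommGroup E]
    [SecondCountableTopologyEither X E] {f : X → E} (hf : Continuous f) (μ : Measure X)
    [IsFiniteMeasureOnCompacts μ] : Integrable f μ :=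
  hf.integrable_of_hasCompactSupport (HasCompactSupport.of_compactSpace f)

/-! ### Integral formulas for functions holomorphic near the closed bidisc -/

section Bidisc

variable {G : ℂ × ℂ → ℂ}
  (hG : ∀ p ∈ closedBall (0 : ℂ) 1 ×ˢ closedBall (0 : ℂ) 1, DifferentiableAt ℂ G p)

include hG

theorem continuous_torus : Continuous fun s : UnitCircle × UnitCircle ↦ G (s.1, s.2) :=
  continuous_iff_continuousAt.2 fun s ↦ ContinuousAt.comp
    (f := fun s : UnitCircle × UnitCircle ↦ ((s.1 : ℂ), (s.2 : ℂ))) (hG (s.1, s.2) (by simp)).continuousAt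
    (by fun_prop)

theorem differentiableAt_fst_slice {x y : ℂ} (hx : x ∈ closedBall (0 : ℂ) 1)
    (hy : y ∈ closedBall (0 : ℂ) 1) : DifferentiableAt ℂ (fun x ↦ G (x, y)) x :=
  DifferentiableAt.comp x (hG (x, y) ⟨hx, hy⟩) (by fun_prop)

theorem differentiableAt_snd_slice {x y : ℂ} (hx : x ∈ closedBall (0 : ℂ) 1)
    (hy : y ∈ closedBall (0 : ℂ) 1) : DifferentiableAt ℂ (fun y ↦ G (x, y)) y :=
  DifferentiableAt.comp y (hG (x, y) ⟨hx, hy⟩) (by fun_prop)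

theorem integral_torus_mul_szego {w₁ w₂ : ℂ} (h₁ : w₁ ∈ ball (0 : ℂ) 1)
    (h₂ : w₂ ∈ ball (0 : ℂ) 1) :
    ∫ s : UnitCircle × UnitCircle, G (s.1, s.2) * (szego w₁ s.1 * szego w₂ s.2)
      ∂(arcMeasure.prod arcMeasure) = G (w₁, w₂) := by
  have c0 := continuous_torus hG
  have c1 := continuous_szego h₁
  have c2 := continuous_szego h₂
  rw [integral_prod _ (Continuous.integrable_of_compactSpace (by exact c0.mul (by fun_prop)) _)]
  have h : ∀ s₁ : UnitCircle, ∫ s₂ : UnitCircle, G (s₁, s₂) * (szego w₁ s₁ * szego w₂ s₂) ∂arcMeasure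
      = G (s₁, w₂) * szego w₁ s₁ := by
    intro s₁
    rw [← integral_mul_szego (g := fun y ↦ G (s₁, y))
      (fun y hy ↦ differentiableAt_snd_slice hG s₁.coe_mem_closedBall hy) h₂, ← integral_mul_const]
    congr! 2 with s₂
    ring
  simp only [h]
  exact integral_mul_szego (g := fun x ↦ G (x, w₂))
    (fun x hx ↦ differentiableAt_fst_slice hG hx (ball_subset_closedBall h₂)) h₁

theorem integral_torus : ∫ s : UnitCircle × UnitCircle, G (s.1, s.2) ∂(arcMeasure.prod arcMeasure)
    = G (0, 0) := by
  simpa using integral_torus_mul_szego hG (w₁ := 0) (w₂ := 0) (by simp) (by simp)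

/-- The conjugate of the integrand is holomorphic in both variables near the closed bidisc, so its
mean is its value at the origin. -/
theorem integral_torus_conj_mul_szego {w₁ w₂ : ℂ} (h₁ : w₁ ∈ ball (0 : ℂ) 1)
    (h₂ : w₂ ∈ ball (0 : ℂ) 1) :
    ∫ s : UnitCircle × UnitCircle, conj (G (s.1, s.2)) * (szego w₁ s.1 * szego w₂ s.2)
      ∂(arcMeasure.prod arcMeasure) = conj (G (0, 0)) := by
  have h := integral_torus
    (G := fun p ↦ G p * ((1 - conj w₁ * p.1)⁻¹ * (1 - conj w₂ * p.2)⁻¹)) (by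
      intro p hp
      have e1 := one_sub_mul_ne_zero (conj_mem_unitBall h₁) hp.1
      have e2 := one_sub_mul_ne_zero (conj_mem_unitBall h₂) hp.2
      have := hG p hp
      fun_prop (disch := assumption))
  rw [← conj_conj (∫ s : UnitCircle × UnitCircle, _ ∂_), ← integral_conj]
  simp only [szego, map_mul, map_inv₀, map_sub, map_one, conj_conj]
  rw [h]
  simp

/-- With `s₂` fixed, the integrand is holomorphic in `s₁` and vanishes at `s₁ = 0`. Hence the
integration over `s₁` is carried out first. -/
theorem integral_torus_mul_shiftedSzego {w₁ w₂ : ℂ} (h₁ : w₁ ∈ ball (0 : ℂ) 1)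
    (h₂ : w₂ ∈ ball (0 : ℂ) 1) :
    ∫ s : UnitCircle × UnitCircle, G (s.1, s.2) * (shiftedSzego w₁ s.1 * conj (shiftedSzego w₂ s.2))
      ∂(arcMeasure.prod arcMeasure) = 0 := by
  have c0 := continuous_torus hG
  have c1 := continuous_shiftedSzego h₁
  have c2 := continuous_shiftedSzego h₂
  rw [integral_prod_symm _ (Continuous.integrable_of_compactSpace (by exact c0.mul (by fun_prop)) _)]
  refine integral_eq_zero_of_ae (.of_forall fun s₂ ↦ ?_)
  simp only [← mul_assoc, integral_mul_const, Pi.zero_apply, mul_eq_zero]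
  refine Or.inl (integral_eq_zero_of_vanishing
    (g := fun x ↦ G (x, s₂) * (x * (1 - conj w₁ * x)⁻¹)) (fun x hx ↦ ?_) (by simp))
  have e1 := one_sub_mul_ne_zero (conj_mem_unitBall h₁) hx
  exact (differentiableAt_fst_slice hG hx s₂.coe_mem_closedBall).mul
    (by fun_prop (disch := assumption))

/-- Here it is the integration over `s₂` that gives zero: the conjugate of the integrand is
holomorphic in `s₂` and vanishes at `s₂ = 0`. -/
theorem integral_torus_conj_mul_shiftedSzego {w₁ w₂ : ℂ} (h₁ : w₁ ∈ ball (0 : ℂ) 1)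
    (h₂ : w₂ ∈ ball (0 : ℂ) 1) :
    ∫ s : UnitCircle × UnitCircle,
      conj (G (s.1, s.2)) * (shiftedSzego w₁ s.1 * conj (shiftedSzego w₂ s.2))
      ∂(arcMeasure.prod arcMeasure) = 0 := by
  have c0 := continuous_torus hG
  have c1 := continuous_shiftedSzego h₁
  have c2 := continuous_shiftedSzego h₂
  rw [integral_prod _ (Continuous.integrable_of_compactSpace
    (by exact (continuous_conj.comp c0).mul (by fun_prop)) _)]
  refine integral_eq_zero_of_ae (.of_forall fun s₁ ↦ ?_)
  change ∫ s₂ : UnitCircle, conj (G (s₁, s₂)) * _ ∂arcMeasure = 0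
  rw [← conj_conj (∫ s : UnitCircle, _ ∂_), ← integral_conj, map_eq_zero]
  simp only [map_mul, conj_conj, mul_left_comm _ (conj (shiftedSzego w₁ s₁)), integral_const_mul,
    mul_eq_zero]
  refine Or.inr (integral_eq_zero_of_vanishing
    (g := fun y ↦ G (s₁, y) * (y * (1 - conj w₂ * y)⁻¹)) (fun x hx ↦ ?_) (by simp))
  have e1 := one_sub_mul_ne_zero (conj_mem_unitBall h₂) hx
  exact (differentiableAt_snd_slice hG s₁.coe_mem_closedBall hx).mul
    (by fun_prop (disch := assumption))

theorem integral_torus_re_mul {k : UnitCircle × UnitCircle → ℂ} (hk : Continuous k) :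
    ∫ s : UnitCircle × UnitCircle, ((G (s.1, s.2)).re : ℂ) * k s ∂(arcMeasure.prod arcMeasure)
      = (∫ s : UnitCircle × UnitCircle, G (s.1, s.2) * k s ∂(arcMeasure.prod arcMeasure)
        + ∫ s : UnitCircle × UnitCircle, conj (G (s.1, s.2)) * k s ∂(arcMeasure.prod arcMeasure)) / 2 := by
  have c0 := continuous_torus hG
  rw [← integral_add (Continuous.integrable_of_compactSpace (by exact c0.mul hk) _)
    (Continuous.integrable_of_compactSpace (by exact (continuous_conj.comp c0).mul hk) _), ← integral_div]
  congr! 2 with s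
  rw [Complex.re_eq_add_conj]
  ring

theorem integral_torus_re_mul_szego {w₁ w₂ : ℂ} (h₁ : w₁ ∈ ball (0 : ℂ) 1)
    (h₂ : w₂ ∈ ball (0 : ℂ) 1) :
    ∫ s : UnitCircle × UnitCircle, ((G (s.1, s.2)).re : ℂ) * (2 * (szego w₁ s.1 * szego w₂ s.2) - 1)
      ∂(arcMeasure.prod arcMeasure) = G (w₁, w₂) - I * (G (0, 0)).im := by
  have c0 := continuous_torus hG
  have c1 := continuous_szego h₁
  have c2 := continuous_szego h₂
  have c3 := continuous_ofReal.comp (continuous_re.comp c0)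
  have h1 := integral_torus_re_mul hG (k := fun s ↦ szego w₁ s.1 * szego w₂ s.2) (by fun_prop)
  have h2 := integral_torus_re_mul hG (k := fun s ↦ 1) (by fun_prop)
  have h3 := integral_torus_conj_mul_szego hG (w₁ := 0) (w₂ := 0) (by simp) (by simp)
  simp only [szego_zero, mul_one] at h2 h3
  rw [integral_torus_mul_szego hG h₁ h₂, integral_torus_conj_mul_szego hG h₁ h₂] at h1
  rw [integral_torus hG, h3] at h2
  simp only [mul_sub, mul_one, mul_left_comm _ (2 : ℂ)]
  rw [integral_sub (Continuous.integrable_of_compactSpace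
      (by exact continuous_const.mul (c3.mul (by fun_prop))) _)
    (Continuous.integrable_of_compactSpace (by exact c3) _), integral_const_mul, h1, h2]
  have h4 := Complex.im_eq_sub_conj (G (0, 0))
  rw [h4]
  field_simp [I_ne_zero]
  ring

theorem integral_torus_re_mul_shiftedSzego {w₁ w₂ : ℂ} (h₁ : w₁ ∈ ball (0 : ℂ) 1)
    (h₂ : w₂ ∈ ball (0 : ℂ) 1) :
    ∫ s : UnitCircle × UnitCircle,
      ((G (s.1, s.2)).re : ℂ) * (shiftedSzego w₁ s.1 * conj (shiftedSzego w₂ s.2))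
      ∂(arcMeasure.prod arcMeasure) = 0 := by
  have c1 := continuous_shiftedSzego h₁
  have c2 := continuous_shiftedSzego h₂
  rw [integral_torus_re_mul hG
    (k := fun s ↦ shiftedSzego w₁ s.1 * conj (shiftedSzego w₂ s.2)) (by fun_prop),
    integral_torus_mul_shiftedSzego hG h₁ h₂, integral_torus_conj_mul_shiftedSzego hG h₁ h₂]
  simp

end Bidisc

/-! ### Herglotz measures on the torus by weak compactness -/

/-- The measure on the torus whose density with respect to arc length is `Re G`. -/
noncomputable def reMeasure (G : ℂ × ℂ → ℂ) : Measure (UnitCircle × UnitCircle) :=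
  (arcMeasure.prod arcMeasure).withDensity fun s ↦ ENNReal.ofReal (G (s.1, s.2)).re

section ReMeasure

variable {G : ℂ × ℂ → ℂ}
  (hG : ∀ p ∈ closedBall (0 : ℂ) 1 ×ˢ closedBall (0 : ℂ) 1, DifferentiableAt ℂ G p)

include hG

theorem isFiniteMeasure_reMeasure : IsFiniteMeasure (reMeasure G) := by
  have c : Continuous fun s : UnitCircle × UnitCircle ↦ (G (s.1, s.2)).re :=
    continuous_re.comp (continuous_torus hG)
  exact isFiniteMeasure_withDensity_ofReal (c.integrable_of_compactSpace _).2

theorem integral_reMeasure (hre : ∀ s : UnitCircle × UnitCircle, 0 ≤ (G (s.1, s.2)).re)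
    (k : UnitCircle × UnitCircle → ℂ) :
    ∫ s, k s ∂(reMeasure G)
      = ∫ s : UnitCircle × UnitCircle, ((G (s.1, s.2)).re : ℂ) * k s
        ∂(arcMeasure.prod arcMeasure) := by
  have c : Continuous fun s : UnitCircle × UnitCircle ↦ (G (s.1, s.2)).re :=
    continuous_re.comp (continuous_torus hG)
  rw [reMeasure, integral_withDensity_eq_integral_toReal_smul c.measurable.ennreal_ofReal
    (.of_forall fun _ ↦ ENNReal.ofReal_lt_top)]
  congr! 2 with s
  rw [ENNReal.toReal_ofReal (hre s), real_smul]

theorem reMeasure_real_univ (hre : ∀ s : UnitCircle × UnitCircle, 0 ≤ (G (s.1, s.2)).re) :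
    (reMeasure G).real univ = (G (0, 0)).re := by
  have h1 := integral_reMeasure hG hre (fun _ ↦ 1)
  have h2 := integral_torus_re_mul_szego hG (w₁ := 0) (w₂ := 0) (by simp) (by simp)
  simp only [szego_zero, mul_one] at h2
  norm_num at h2
  rw [integral_const] at h1
  simp only [real_smul, mul_one] at h1
  rw [h2] at h1
  have := congrArg Complex.re h1
  simpa using this

end ReMeasure

/-- `F` need not extend to the torus, so the formulas are applied to the dilates `F (r p)` with `r <
1`. The measures `Re F (r s)` all have mass `Re F (0, 0)`, hence a weak limit point, and both
kernels are continuous on the torus. -/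
theorem exists_torus_measure {F : ℂ × ℂ → ℂ}
    (hF : DifferentiableOn ℂ F (ball (0 : ℂ) 1 ×ˢ ball (0 : ℂ) 1))
    (hre : ∀ p ∈ ball (0 : ℂ) 1 ×ˢ ball (0 : ℂ) 1, 0 ≤ (F p).re) :
    ∃ ν : Measure (UnitCircle × UnitCircle), IsFiniteMeasure ν ∧
      ∀ w₁ ∈ ball (0 : ℂ) 1, ∀ w₂ ∈ ball (0 : ℂ) 1,
        F (w₁, w₂) = I * (F (0, 0)).im
          + ∫ s, (2 * (szego w₁ s.1 * szego w₂ s.2) - 1) ∂ν ∧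
        ∫ s, shiftedSzego w₁ s.1 * conj (shiftedSzego w₂ s.2) ∂ν = 0 := by
  obtain ⟨r, -, hr, hlim⟩ := exists_seq_strictMono_tendsto' (zero_lt_one (α := ℝ))
  have hmem : ∀ n, ∀ x ∈ closedBall (0 : ℂ) 1, (r n : ℂ) * x ∈ ball (0 : ℂ) 1 := by
    intro n x hx
    rw [mem_closedBall_zero_iff] at hx
    rw [mem_ball_zero_iff, norm_mul, norm_real, Real.norm_of_nonneg (hr n).1.le]
    nlinarith [(hr n).1, (hr n).2]
  have hopen : IsOpen (ball (0 : ℂ) 1 ×ˢ ball (0 : ℂ) 1) := isOpen_ball.prod isOpen_ball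
  set G : ℕ → ℂ × ℂ → ℂ := fun n p ↦ F (r n * p.1, r n * p.2) with hGdef
  have hG : ∀ n, ∀ p ∈ closedBall (0 : ℂ) 1 ×ˢ closedBall (0 : ℂ) 1,
      DifferentiableAt ℂ (G n) p := fun n p hp ↦
    DifferentiableAt.comp p ((hF _ ⟨hmem n _ hp.1, hmem n _ hp.2⟩).differentiableAt
      (hopen.mem_nhds ⟨hmem n _ hp.1, hmem n _ hp.2⟩))
      (f := fun p : ℂ × ℂ ↦ ((r n : ℂ) * p.1, (r n : ℂ) * p.2)) (by fun_prop)
  have hGre : ∀ n, ∀ s : UnitCircle × UnitCircle, 0 ≤ (G n (s.1, s.2)).re := fun n s ↦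
    hre _ ⟨hmem n _ s.1.coe_mem_closedBall, hmem n _ s.2.coe_mem_closedBall⟩
  have hG0 : ∀ n, G n (0, 0) = F (0, 0) := fun n ↦ by simp [hGdef]
  let νs : ℕ → FiniteMeasure (UnitCircle × UnitCircle) := fun n ↦
    ⟨reMeasure (G n), isFiniteMeasure_reMeasure (hG n)⟩
  have hmass : ∀ n, (νs n).mass ≤ (F (0, 0)).re.toNNReal := by
    intro n
    rw [← NNReal.coe_le_coe, Real.coe_toNNReal _ (hre _ (by simp)), ← hG0 n,
      ← reMeasure_real_univ (hG n) (hGre n)]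
    exact le_of_eq rfl
  -- Taking the limit along an ultrafilter avoids extracting a subsequence.
  obtain ⟨ν, -, hν⟩ := (isCompact_setOfPred_finiteMeasure_le_of_compactSpace
    (UnitCircle × UnitCircle) (F (0, 0)).re.toNNReal).ultrafilter_le_nhds
      ((hyperfilter ℕ).map νs) (by
        rw [le_principal_iff]
        exact univ_mem' (f := (hyperfilter ℕ : Filter ℕ)) hmass)
  have hν' : Tendsto νs (hyperfilter ℕ) (𝓝 ν) := hν
  rw [FiniteMeasure.tendsto_iff_forall_integral_rclike_tendsto ℂ] at hν'
  have key : ∀ k : UnitCircle × UnitCircle → ℂ, Continuous k →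
      Tendsto (fun n ↦ ∫ s : UnitCircle × UnitCircle, ((G n (s.1, s.2)).re : ℂ) * k s
        ∂(arcMeasure.prod arcMeasure)) (hyperfilter ℕ)
        (𝓝 (∫ s, k s ∂(ν : Measure (UnitCircle × UnitCircle)))) := by
    intro k hk
    have h := hν' (BoundedContinuousFunction.mkOfCompact ⟨k, hk⟩)
    refine h.congr fun n ↦ ?_
    exact integral_reMeasure (hG n) (hGre n) k
  refine ⟨ν, inferInstance, fun w₁ h₁ w₂ h₂ ↦ ⟨?_, ?_⟩⟩
  · have c1 := continuous_szego h₁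
    have c2 := continuous_szego h₂
    have h := key (fun s ↦ 2 * (szego w₁ s.1 * szego w₂ s.2) - 1) (by fun_prop)
    simp only [integral_torus_re_mul_szego (hG _) h₁ h₂, hG0] at h
    have hl : Tendsto (fun n ↦ G n (w₁, w₂)) atTop (𝓝 (F (w₁, w₂))) := by
      have hc : ContinuousAt F (w₁, w₂) :=
        (hF _ ⟨h₁, h₂⟩).differentiableAt (hopen.mem_nhds ⟨h₁, h₂⟩) |>.continuousAt
      refine hc.tendsto.comp (Tendsto.prodMk_nhds ?_ ?_)
      · simpa using ((continuous_ofReal.tendsto 1).comp hlim).mul_const w₁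
      · simpa using ((continuous_ofReal.tendsto 1).comp hlim).mul_const w₂
    have h' := tendsto_nhds_unique h
      ((hl.mono_left Nat.hyperfilter_le_atTop).sub_const (I * (F (0, 0)).im))
    rw [h']
    ring
  · have c1 := continuous_shiftedSzego h₁
    have c2 := continuous_shiftedSzego h₂
    have h := key (fun s ↦ shiftedSzego w₁ s.1 * conj (shiftedSzego w₂ s.2)) (by fun_prop)
    simp only [integral_torus_re_mul_shiftedSzego (hG _) h₁ h₂] at h
    exact tendsto_nhds_unique h tendsto_const_nhds

/-! ### The part of the measure on the circles at infinity -/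

/-- The point `1` of the unit circle, corresponding to infinity on the real line. -/
def UnitCircle.one : UnitCircle := ⟨1, by simp⟩

theorem UnitCircle.coe_eq_one_iff {s : UnitCircle} : (s : ℂ) = 1 ↔ s = UnitCircle.one := by
  rw [Subtype.ext_iff]; rfl

theorem measurableSet_singleton_one : MeasurableSet ({UnitCircle.one} : Set UnitCircle) :=
  measurableSet_singleton _

theorem ofReal_mem_unitBall {r : ℝ} (hr : r ∈ Ioo (0 : ℝ) 1) : (r : ℂ) ∈ ball (0 : ℂ) 1 := by
  rw [mem_ball_zero_iff, norm_real, Real.norm_of_nonneg hr.1.le]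
  exact hr.2

/-- Multiplying by `(1 - r)` and letting `r → 1`, the kernels `shiftedSzego r` converge boundedly
to the indicator function of the point `1`. -/
theorem tendsto_integral_shiftedSzego {X : Type*} [MeasurableSpace X] {ν : Measure X}
    {g : X → UnitCircle} (hg : Measurable g) {h : X → ℂ} (hh : Integrable h ν)
    {r : ℕ → ℝ} (hr : ∀ n, r n ∈ Ioo (0 : ℝ) 1) (hlim : Tendsto r atTop (𝓝 1)) :
    Tendsto (fun n ↦ ∫ x, (1 - r n) * shiftedSzego (r n) (g x) * h x ∂ν) atTop
      (𝓝 (∫ x in g ⁻¹' {UnitCircle.one}, h x ∂ν)) := by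
  rw [← integral_indicator (hg measurableSet_singleton_one)]
  refine tendsto_integral_of_dominated_convergence (fun x ↦ ‖h x‖) (fun n ↦ ?_) hh.norm
    (fun n ↦ .of_forall fun x ↦ ?_) (.of_forall fun x ↦ ?_)
  · exact (((continuous_shiftedSzego (ofReal_mem_unitBall (hr n))).measurable.comp hg).const_mul
      _).aestronglyMeasurable.mul hh.1
  · rw [norm_mul]
    refine mul_le_of_le_one_left (norm_nonneg _) ?_
    have h1 : (1 - r n : ℂ) = ((1 - r n : ℝ) : ℂ) := by push_cast; rfl
    -- This bound makes the rescaled kernels at most `1` in norm, so `‖h‖` dominates.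
    have h2 : 1 - r n ≤ ‖1 - (r n : ℂ) * (g x : ℂ)‖ := by
      have h3 := norm_sub_norm_le (1 : ℂ) ((r n : ℂ) * (g x : ℂ))
      rwa [norm_mul, norm_real, Real.norm_of_nonneg (hr n).1.le, UnitCircle.norm_coe, mul_one,
        norm_one] at h3
    have h4 : 0 < 1 - r n := sub_pos.2 (hr n).2
    rw [shiftedSzego, conj_ofReal, norm_mul, norm_mul, norm_inv, UnitCircle.norm_coe, one_mul, h1,
      norm_real, Real.norm_of_nonneg h4.le, ← div_eq_mul_inv]
    exact div_le_one_of_le₀ h2 (norm_nonneg _)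
  · have hl : Tendsto (fun n ↦ (r n : ℂ)) atTop (𝓝 1) := by
      exact_mod_cast (continuous_ofReal.tendsto 1).comp hlim
    by_cases hx : g x = UnitCircle.one
    · rw [indicator_of_mem (by exact hx)]
      refine tendsto_const_nhds.congr fun n ↦ ?_
      have h5 : (1 - r n : ℂ) ≠ 0 := by
        rw [← ofReal_one, ← ofReal_sub, ofReal_ne_zero]
        exact (sub_pos.2 (hr n).2).ne'
      rw [shiftedSzego, UnitCircle.coe_eq_one_iff.2 hx, conj_ofReal, mul_one, one_mul,
        mul_inv_cancel₀ h5, one_mul]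
    · rw [indicator_of_notMem (by exact hx)]
      have h6 : (1 - 1 * (g x : ℂ)) ≠ 0 := by
        rw [one_mul, sub_ne_zero]
        exact fun h ↦ hx (UnitCircle.coe_eq_one_iff.1 h.symm)
      have := ((((hl.const_sub 1).mul
        ((((hl.mul_const (g x : ℂ)).const_sub 1).inv₀ h6).const_mul (g x : ℂ))).mul_const (h x)))
      simpa [shiftedSzego] using this

/-- Separates the constant Fourier mode from the others, which integrate to zero on the circles at
infinity. -/
theorem szego_eq_one_add {w : ℂ} (hw : w ∈ ball (0 : ℂ) 1) (s : UnitCircle) :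
    szego w s = 1 + w * conj (shiftedSzego w s) := by
  have h := UnitCircle.one_sub_mul_conj_ne_zero hw s
  simp only [szego, shiftedSzego, map_mul, map_inv₀, map_sub, map_one, conj_conj]
  field_simp
  ring

theorem szego_one (w : ℂ) : szego w UnitCircle.one = (1 - w)⁻¹ := by
  simp [szego, UnitCircle.one]

section Lines

variable {ν : Measure (UnitCircle × UnitCircle)} [IsFiniteMeasure ν]
  (hν : ∀ w₁ ∈ ball (0 : ℂ) 1, ∀ w₂ ∈ ball (0 : ℂ) 1,
    ∫ s, shiftedSzego w₁ s.1 * conj (shiftedSzego w₂ s.2) ∂ν = 0)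

/-- The circle in the torus on which the first coordinate is at infinity. -/
def lineFst : Set (UnitCircle × UnitCircle) := Prod.fst ⁻¹' {UnitCircle.one}

/-- The circle in the torus on which the second coordinate is at infinity. -/
def lineSnd : Set (UnitCircle × UnitCircle) := Prod.snd ⁻¹' {UnitCircle.one}

theorem measurableSet_lineFst : MeasurableSet lineFst :=
  measurable_fst measurableSet_singleton_one

theorem measurableSet_lineSnd : MeasurableSet lineSnd :=
  measurable_snd measurableSet_singleton_one

include hν

/-- Localising the orthogonality relation at `s₁ = 1` shows that `ν` has no nonconstant Fourier mode
on this circle. -/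
theorem setIntegral_lineFst {w : ℂ} (hw : w ∈ ball (0 : ℂ) 1) :
    ∫ s in lineFst, conj (shiftedSzego w s.2) ∂ν = 0 := by
  have c := continuous_shiftedSzego hw
  obtain ⟨r, -, hr, hlim⟩ := exists_seq_strictMono_tendsto' (zero_lt_one (α := ℝ))
  have h := tendsto_integral_shiftedSzego (ν := ν) measurable_fst
    (h := fun s ↦ conj (shiftedSzego w s.2))
    (Continuous.integrable_of_compactSpace (by fun_prop) _) hr hlim
  simp only [mul_assoc, integral_const_mul, hν _ (ofReal_mem_unitBall (hr _)) _ hw, mul_zero] at h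
  exact tendsto_nhds_unique h tendsto_const_nhds

theorem setIntegral_lineSnd {w : ℂ} (hw : w ∈ ball (0 : ℂ) 1) :
    ∫ s in lineSnd, shiftedSzego w s.1 ∂ν = 0 := by
  have c := continuous_shiftedSzego hw
  obtain ⟨r, -, hr, hlim⟩ := exists_seq_strictMono_tendsto' (zero_lt_one (α := ℝ))
  have h := tendsto_integral_shiftedSzego (ν := ν) measurable_snd
    (h := fun s ↦ conj (shiftedSzego w s.1))
    (Continuous.integrable_of_compactSpace (by fun_prop) _) hr hlim
  -- Conjugating the orthogonality relation exchanges the roles of the two variables.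
  have h0 : ∀ n, ∫ s, shiftedSzego (r n) s.2 * conj (shiftedSzego w s.1) ∂ν = 0 := by
    intro n
    rw [← conj_conj (∫ s, _ ∂_), ← integral_conj]
    simp only [map_mul, conj_conj, mul_comm (conj (shiftedSzego (r n) _)),
      hν _ hw _ (ofReal_mem_unitBall (hr n)), map_zero]
  simp only [mul_assoc, integral_const_mul, h0, mul_zero] at h
  have h' := tendsto_nhds_unique h tendsto_const_nhds
  rw [integral_conj, map_eq_zero] at h'
  exact h'

/-- A second localisation, now at `s₂ = 1` for the restriction of `ν` to the first circle, isolates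
the mass at the corner as a limit of zeros. -/
theorem measure_lineFst_inter_lineSnd : ν (lineFst ∩ lineSnd) = 0 := by
  obtain ⟨r, -, hr, hlim⟩ := exists_seq_strictMono_tendsto' (zero_lt_one (α := ℝ))
  have h := tendsto_integral_shiftedSzego (ν := ν.restrict lineFst) measurable_snd
    (h := fun _ ↦ 1) (integrable_const _) hr hlim
  have h0 : ∀ n, ∫ s in lineFst, shiftedSzego (r n) s.2 ∂ν = 0 := fun n ↦ by
    have := setIntegral_lineFst hν (ofReal_mem_unitBall (hr n))
    rwa [integral_conj, map_eq_zero] at this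
  simp only [mul_one, integral_const_mul, h0, mul_zero] at h
  have h' := tendsto_nhds_unique h tendsto_const_nhds
  rw [setIntegral_const, real_smul, mul_one, ofReal_eq_zero] at h'
  change (ν.restrict lineFst).real lineSnd = 0 at h'
  rwa [measureReal_eq_zero_iff, Measure.restrict_apply measurableSet_lineSnd, inter_comm] at h'

theorem integral_eq_add_lines {k : UnitCircle × UnitCircle → ℂ} (hk : Continuous k) :
    ∫ s, k s ∂ν = ∫ s in (lineFst ∪ lineSnd)ᶜ, k s ∂ν + ∫ s in lineFst, k s ∂ν
      + ∫ s in lineSnd, k s ∂ν := by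
  have hi := hk.integrable_of_compactSpace ν
  rw [← integral_add_compl (measurableSet_lineFst.union measurableSet_lineSnd) hi,
    setIntegral_union₀ (measure_lineFst_inter_lineSnd hν)
      measurableSet_lineSnd.nullMeasurableSet hi.integrableOn hi.integrableOn]
  ring

theorem integral_szego_eq {w₁ w₂ : ℂ} (h₁ : w₁ ∈ ball (0 : ℂ) 1) (h₂ : w₂ ∈ ball (0 : ℂ) 1) :
    ∫ s, (2 * (szego w₁ s.1 * szego w₂ s.2) - 1) ∂ν
      = ∫ s in (lineFst ∪ lineSnd)ᶜ, (2 * (szego w₁ s.1 * szego w₂ s.2) - 1) ∂ν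
        + ν.real lineFst * (2 * (1 - w₁)⁻¹ - 1) + ν.real lineSnd * (2 * (1 - w₂)⁻¹ - 1) := by
  have c1 := continuous_szego h₁
  have c2 := continuous_szego h₂
  have d1 := continuous_shiftedSzego h₁
  have d2 := continuous_shiftedSzego h₂
  rw [integral_eq_add_lines hν (by fun_prop)]
  congr 2
  · have h : ∀ s ∈ lineFst, 2 * (szego w₁ s.1 * szego w₂ s.2) - 1
        = (2 * (1 - w₁)⁻¹ - 1) + 2 * (1 - w₁)⁻¹ * w₂ * conj (shiftedSzego w₂ s.2) := by
      intro s hs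
      have hs' : s.1 = UnitCircle.one := hs
      rw [hs', szego_one, szego_eq_one_add h₂]
      ring
    rw [setIntegral_congr_fun measurableSet_lineFst h,
      integral_add (integrable_const _) (Continuous.integrable_of_compactSpace (by fun_prop) _),
      integral_const_mul, setIntegral_lineFst hν h₂, mul_zero, add_zero, setIntegral_const,
      real_smul]
  · have h : ∀ s ∈ lineSnd, 2 * (szego w₁ s.1 * szego w₂ s.2) - 1
        = (2 * (1 - w₂)⁻¹ - 1) + 2 * (1 - w₂)⁻¹ * w₁ * conj (shiftedSzego w₁ s.1) := by
      intro s hs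
      have hs' : s.2 = UnitCircle.one := hs
      rw [hs', szego_one, szego_eq_one_add h₁]
      ring
    rw [setIntegral_congr_fun measurableSet_lineSnd h,
      integral_add (integrable_const _) (Continuous.integrable_of_compactSpace (by fun_prop) _),
      integral_const_mul, integral_conj, setIntegral_lineSnd hν h₁, map_zero, mul_zero, add_zero,
      setIntegral_const, real_smul]

theorem setIntegral_shiftedSzego_eq_zero {w₁ w₂ : ℂ} (h₁ : w₁ ∈ ball (0 : ℂ) 1)
    (h₂ : w₂ ∈ ball (0 : ℂ) 1) :
    ∫ s in (lineFst ∪ lineSnd)ᶜ, shiftedSzego w₁ s.1 * conj (shiftedSzego w₂ s.2) ∂ν = 0 := by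
  have d1 := continuous_shiftedSzego h₁
  have d2 := continuous_shiftedSzego h₂
  have h := integral_eq_add_lines hν
    (k := fun s ↦ shiftedSzego w₁ s.1 * conj (shiftedSzego w₂ s.2)) (by fun_prop)
  have e1 : ∫ s in lineFst, shiftedSzego w₁ s.1 * conj (shiftedSzego w₂ s.2) ∂ν = 0 := by
    rw [setIntegral_congr_fun (g := fun s ↦ shiftedSzego w₁ UnitCircle.one
        * conj (shiftedSzego w₂ s.2)) measurableSet_lineFst (fun s hs ↦ by
          have hs' : s.1 = UnitCircle.one := hs
          simp only [hs']),
      integral_const_mul, setIntegral_lineFst hν h₂, mul_zero]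
  have e2 : ∫ s in lineSnd, shiftedSzego w₁ s.1 * conj (shiftedSzego w₂ s.2) ∂ν = 0 := by
    rw [setIntegral_congr_fun (g := fun s ↦ shiftedSzego w₁ s.1
        * conj (shiftedSzego w₂ UnitCircle.one)) measurableSet_lineSnd (fun s hs ↦ by
          have hs' : s.2 = UnitCircle.one := hs
          simp only [hs']),
      integral_mul_const, setIntegral_lineSnd hν h₁, zero_mul]
  rw [hν _ h₁ _ h₂, e1, e2, add_zero, add_zero] at h
  exact h.symm

end Lines

/-! ### The Cayley transform and the kernels in real coordinates -/

theorem ofReal_add_I_ne_zero (t : ℝ) : (t : ℂ) + I ≠ 0 := fun h ↦ by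
  simpa using congrArg Complex.im h

theorem ofReal_sub_I_ne_zero (t : ℝ) : (t : ℂ) - I ≠ 0 := fun h ↦ by
  simpa using congrArg Complex.im h

theorem add_I_ne_zero {z : ℂ} (hz : 0 < z.im) : z + I ≠ 0 := fun h ↦ by
  have := congrArg Complex.im h
  simp only [add_im, I_im, zero_im] at this
  linarith

theorem ofReal_sub_ne_zero {z : ℂ} (hz : 0 < z.im) (t : ℝ) : (t : ℂ) - z ≠ 0 := fun h ↦ by
  have := congrArg Complex.im h
  simp only [sub_im, ofReal_im, zero_im] at this
  linarith

theorem ofReal_sub_conj_ne_zero {z : ℂ} (hz : 0 < z.im) (t : ℝ) : (t : ℂ) - conj z ≠ 0 := fun h ↦ by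
  have := congrArg Complex.im h
  simp only [sub_im, ofReal_im, zero_im, conj_im] at this
  linarith

theorem one_add_sq_eq (t : ℝ) : (1 + (t : ℂ) ^ 2) = (t + I) * (t - I) := by
  linear_combination I_sq

/-- The Cayley transform of the upper half-plane onto the unit disc. -/
noncomputable def cayley (z : ℂ) : ℂ := (z - I) / (z + I)

/-- The inverse Cayley transform. -/
noncomputable def cayleyInv (w : ℂ) : ℂ := I * (1 + w) / (1 - w)

theorem cayley_mem_ball {z : ℂ} (hz : 0 < z.im) : cayley z ∈ ball (0 : ℂ) 1 := by
  have h := add_I_ne_zero hz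
  rw [mem_ball_zero_iff, cayley, norm_div, div_lt_one (norm_pos_iff.2 h),
    ← abs_of_nonneg (norm_nonneg (z - I)), ← abs_of_nonneg (norm_nonneg (z + I)), ← sq_lt_sq,
    ← normSq_eq_norm_sq, ← normSq_eq_norm_sq, normSq_apply, normSq_apply]
  simp
  nlinarith

theorem one_sub_ne_zero_of_mem_ball {w : ℂ} (hw : w ∈ ball (0 : ℂ) 1) : 1 - w ≠ 0 := by
  simpa using one_sub_mul_ne_zero hw (s := 1) (by simp)

theorem cayleyInv_im_pos {w : ℂ} (hw : w ∈ ball (0 : ℂ) 1) : 0 < (cayleyInv w).im := by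
  have h := one_sub_ne_zero_of_mem_ball hw
  have h1 : normSq w < 1 := by
    rw [mem_ball_zero_iff] at hw
    rw [normSq_eq_norm_sq]
    nlinarith [norm_nonneg w]
  have h2 : (cayleyInv w).im = (1 - normSq w) / normSq (1 - w) := by
    rw [cayleyInv, div_im, normSq_apply w]
    simp
    ring
  rw [h2]
  exact div_pos (by linarith) (normSq_pos.2 h)

theorem cayleyInv_cayley {z : ℂ} (hz : 0 < z.im) : cayleyInv (cayley z) = z := by
  have h := add_I_ne_zero hz
  have h1 : 1 - cayley z = 2 * I / (z + I) := by
    rw [cayley]; field_simp; ring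
  have h2 : 1 + cayley z = 2 * z / (z + I) := by
    rw [cayley]; field_simp; ring
  rw [cayleyInv, h1, h2]
  field_simp

/-- The Cayley transform of the real line into the unit circle. -/
noncomputable def cayleyReal (t : ℝ) : UnitCircle :=
  ⟨cayley t, by
    have h : (t : ℂ) - I = conj ((t : ℂ) + I) := by simp [sub_eq_add_neg]
    rw [mem_sphere_zero_iff_norm, cayley, norm_div, h, norm_conj,
      div_self (norm_ne_zero_iff.2 (ofReal_add_I_ne_zero t))]⟩

theorem coe_cayleyReal (t : ℝ) : (cayleyReal t : ℂ) = (t - I) / (t + I) := rfl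

theorem conj_coe_cayleyReal (t : ℝ) : conj (cayleyReal t : ℂ) = (t + I) / (t - I) := by
  simp [coe_cayleyReal, sub_eq_add_neg]

theorem continuous_cayleyReal : Continuous cayleyReal := by
  refine Continuous.subtype_mk ?_ _
  unfold cayley
  have := ofReal_add_I_ne_zero
  fun_prop (disch := assumption)

theorem cayleyReal_injective : Function.Injective cayleyReal := by
  intro s t h
  have h1 : ((s : ℂ) - I) / (s + I) = (t - I) / (t + I) := congrArg Subtype.val h
  rw [div_eq_div_iff (ofReal_add_I_ne_zero s) (ofReal_add_I_ne_zero t)] at h1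
  have h2 : 2 * I * ((s : ℂ) - t) = 0 := by linear_combination h1
  simpa [I_ne_zero, sub_eq_zero] using h2

theorem range_cayleyReal : range cayleyReal = {UnitCircle.one}ᶜ := by
  ext s
  rw [mem_compl_singleton_iff, Ne, ← UnitCircle.coe_eq_one_iff]
  constructor
  · rintro ⟨t, rfl⟩ h
    rw [coe_cayleyReal, div_eq_one_iff_eq (ofReal_add_I_ne_zero t)] at h
    have := congrArg Complex.im h
    norm_num at this
  · intro h
    have h1 : 1 - (s : ℂ) ≠ 0 := sub_ne_zero.2 (Ne.symm h)
    have h2 : normSq (s : ℂ) = 1 := by rw [normSq_eq_norm_sq, s.norm_coe, one_pow]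
    -- The preimage of `s` is `cayleyInv s`, which is real because `s` has modulus one.
    have h3 : (cayleyInv s).im = 0 := by
      rw [cayleyInv, div_im]
      rw [normSq_apply] at h2
      have : normSq (1 - (s : ℂ)) ≠ 0 := normSq_pos.2 h1 |>.ne'
      field_simp
      simp
      linear_combination -h2
    have h4 : ((cayleyInv s).re : ℂ) = cayleyInv s := by
      apply Complex.ext <;> simp [h3]
    refine ⟨(cayleyInv s).re, Subtype.ext ?_⟩
    rw [coe_cayleyReal, h4, div_eq_iff (by rw [← h4]; exact ofReal_add_I_ne_zero _), cayleyInv]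
    field_simp
    ring

/-- The Cayley transform of the plane into the torus. -/
noncomputable def cayleyPlane (t : ℝ × ℝ) : UnitCircle × UnitCircle :=
  (cayleyReal t.1, cayleyReal t.2)

theorem measurableEmbedding_cayleyPlane : MeasurableEmbedding cayleyPlane :=
  Continuous.measurableEmbedding
    ((continuous_cayleyReal.comp continuous_fst).prodMk (continuous_cayleyReal.comp continuous_snd))
    (cayleyReal_injective.prodMap cayleyReal_injective)

theorem range_cayleyPlane : range cayleyPlane = (lineFst ∪ lineSnd)ᶜ := by
  change range (Prod.map cayleyReal cayleyReal) = _
  rw [range_prodMap, range_cayleyReal]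
  ext s
  simp [lineFst, lineSnd]

theorem integral_comap_cayleyPlane (ν : Measure (UnitCircle × UnitCircle)) {E : Type*}
    [NormedAddCommGroup E] [NormedSpace ℝ E] (k : UnitCircle × UnitCircle → E) :
    ∫ t, k (cayleyPlane t) ∂(ν.comap cayleyPlane) = ∫ s in (lineFst ∪ lineSnd)ᶜ, k s ∂ν := by
  rw [← measurableEmbedding_cayleyPlane.integral_map, measurableEmbedding_cayleyPlane.map_comap,
    range_cayleyPlane]

/-- The weight `(1 + t₁²) (1 + t₂²)`. -/
def planeWeight (t : ℝ × ℝ) : ℝ := (1 + t.1 ^ 2) * (1 + t.2 ^ 2)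

theorem planeWeight_pos (t : ℝ × ℝ) : 0 < planeWeight t := by
  unfold planeWeight; positivity

theorem continuous_planeWeight : Continuous planeWeight := by
  unfold planeWeight; fun_prop

theorem coe_planeWeight (t : ℝ × ℝ) :
    (planeWeight t : ℂ) = (1 + (t.1 : ℂ) ^ 2) * (1 + (t.2 : ℂ) ^ 2) := by
  simp [planeWeight]

theorem szego_cayley {z : ℂ} (hz : 0 < z.im) (t : ℝ) :
    2 * I * szego (cayley z) (cayleyReal t)
      = (1 + (t : ℂ) ^ 2) * (1 / (t - z) - 1 / (t + I)) := by
  have h1 := add_I_ne_zero hz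
  have h2 := ofReal_sub_ne_zero hz t
  have h3 := ofReal_sub_I_ne_zero t
  have h4 := ofReal_add_I_ne_zero t
  have h5 : 1 - cayley z * conj (cayleyReal t : ℂ)
      = 2 * I * (t - z) / ((z + I) * (t - I)) := by
    rw [conj_coe_cayleyReal, cayley]
    field_simp
    ring
  rw [szego, h5, one_add_sq_eq]
  field_simp
  ring

theorem shiftedSzego_cayley {z : ℂ} (hz : 0 < z.im) (t : ℝ) :
    -2 * I * conj (cayley z) * shiftedSzego (cayley z) (cayleyReal t)
      = (1 + (t : ℂ) ^ 2) * (1 / (t - conj z) - 1 / (t + I)) := by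
  have h1 : conj z - I ≠ 0 := by
    have h := (map_ne_zero (starRingEnd ℂ)).2 (add_I_ne_zero hz)
    simpa [sub_eq_add_neg] using h
  have h2 := ofReal_sub_conj_ne_zero hz t
  have h3 := ofReal_sub_I_ne_zero t
  have h4 := ofReal_add_I_ne_zero t
  have h6 : conj (cayley z) = (conj z + I) / (conj z - I) := by
    simp [cayley, sub_eq_add_neg]
  have h5 : 1 - conj (cayley z) * (cayleyReal t : ℂ)
      = 2 * I * (conj z - t) / ((conj z - I) * (t + I)) := by
    rw [h6, coe_cayleyReal]
    field_simp
    ring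
  have h7 : conj z - t ≠ 0 := by
    rw [← neg_sub]; exact neg_ne_zero.2 h2
  rw [shiftedSzego, h5, h6, one_add_sq_eq, coe_cayleyReal]
  field_simp
  ring

/-- The weight is exactly what the change of variables costs: it carries the unbounded plane kernel
picture to a kernel continuous on the whole torus. -/
theorem kernelK_eq {z : ℂ × ℂ} (hz : z ∈ polyUpperHalfPlane) (t : ℝ × ℝ) :
    planeWeight t * kernelK z t
      = I * (2 * (szego (cayley z.1) (cayleyPlane t).1 * szego (cayley z.2) (cayleyPlane t).2)
        - 1) := by
  have h1 := szego_cayley hz.1 t.1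
  have h2 := szego_cayley hz.2 t.2
  have h3 : (planeWeight t : ℂ) ≠ 0 := ofReal_ne_zero.2 (planeWeight_pos t).ne'
  rw [kernelK, ← coe_planeWeight, mul_sub, mul_div_cancel₀ _ h3, coe_planeWeight]
  calc _ = -(I / 2) * ((1 + (t.1 : ℂ) ^ 2) * (1 / (t.1 - z.1) - 1 / (t.1 + I)))
        * ((1 + (t.2 : ℂ) ^ 2) * (1 / (t.2 - z.2) - 1 / (t.2 + I))) - I := by ring
    _ = _ := by
      rw [← h1, ← h2]
      simp only [cayleyPlane]
      linear_combination (-2 * I * szego (cayley z.1) (cayleyReal t.1)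
        * szego (cayley z.2) (cayleyReal t.2)) * I_sq

/-- The integrand of the Nevanlinna condition. -/
noncomputable def nevanlinnaKernel (z : ℂ × ℂ) (t : ℝ × ℝ) : ℂ :=
  (1 / ((t.1 : ℂ) - conj z.1) - 1 / ((t.1 : ℂ) + I)) *
    (1 / ((t.2 : ℂ) - z.2) - 1 / ((t.2 : ℂ) - I))

theorem nevanlinnaKernel_eq {z : ℂ × ℂ} (hz : z ∈ polyUpperHalfPlane) (t : ℝ × ℝ) :
    planeWeight t * nevanlinnaKernel z t
      = 4 * conj (cayley z.1) * cayley z.2 * (shiftedSzego (cayley z.1) (cayleyPlane t).1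
        * conj (shiftedSzego (cayley z.2) (cayleyPlane t).2)) := by
  have h1 := shiftedSzego_cayley hz.1 t.1
  have h2 := congrArg conj (shiftedSzego_cayley hz.2 t.2)
  simp only [map_mul, map_neg, map_sub, map_add, map_pow, map_div₀, map_one, conj_ofReal, conj_conj,
    conj_I, map_ofNat, ← sub_eq_add_neg] at h2
  rw [coe_planeWeight, nevanlinnaKernel]
  calc _ = ((1 + (t.1 : ℂ) ^ 2) * (1 / (t.1 - conj z.1) - 1 / (t.1 + I)))
        * ((1 + (t.2 : ℂ) ^ 2) * (1 / (t.2 - z.2) - 1 / (t.2 - I))) := by ring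
    _ = _ := by
      rw [← h1, ← h2]
      simp only [cayleyPlane]
      linear_combination (-4 * conj (cayley z.1) * cayley z.2 * (shiftedSzego (cayley z.1)
        (cayleyReal t.1) * conj (shiftedSzego (cayley z.2) (cayleyReal t.2)))) * I_sq

/-! ### From a Herglotz-Nevanlinna function to its representation -/

/-- The measure on the plane that corresponds to a measure on the torus. -/
noncomputable def planeMeasure (ν : Measure (UnitCircle × UnitCircle)) : Measure (ℝ × ℝ) :=
  (ν.comap cayleyPlane).withDensity fun t ↦ ENNReal.ofReal (π ^ 2 * planeWeight t)

theorem integral_planeMeasure (ν : Measure (UnitCircle × UnitCircle)) {E : Type*}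
    [NormedAddCommGroup E] [NormedSpace ℝ E] (f : ℝ × ℝ → E) :
    ∫ t, f t ∂(planeMeasure ν) = π ^ 2 • ∫ t, planeWeight t • f t ∂(ν.comap cayleyPlane) := by
  have c := continuous_planeWeight
  rw [planeMeasure, integral_withDensity_eq_integral_toReal_smul
    (by fun_prop) (.of_forall fun _ ↦ ENNReal.ofReal_lt_top), ← integral_smul]
  congr! 2 with t
  have := planeWeight_pos t
  rw [ENNReal.toReal_ofReal (by positivity), mul_smul]

theorem growthCondition_planeMeasure (ν : Measure (UnitCircle × UnitCircle)) [IsFiniteMeasure ν] :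
    GrowthCondition (planeMeasure ν) := by
  have c := continuous_planeWeight
  have h : ∀ t : ℝ × ℝ, ENNReal.ofReal (π ^ 2 * planeWeight t)
      * ENNReal.ofReal (1 / ((1 + t.1 ^ 2) * (1 + t.2 ^ 2))) = ENNReal.ofReal (π ^ 2) := by
    intro t
    have := planeWeight_pos t
    rw [← ENNReal.ofReal_mul (by positivity)]
    congr 1
    change π ^ 2 * planeWeight t * (1 / planeWeight t) = π ^ 2
    field_simp
  rw [GrowthCondition, planeMeasure, lintegral_withDensity_eq_lintegral_mul _
    (by fun_prop) (by fun_prop)]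
  simp only [Pi.mul_apply, h, lintegral_const]
  rw [measurableEmbedding_cayleyPlane.comap_apply]
  exact ENNReal.mul_lt_top ENNReal.ofReal_lt_top (measure_lt_top _ _)

theorem exists_representation {q : ℂ × ℂ → ℂ} (hq : IsHerglotzNevanlinna q) :
    ∃ (a b₁ b₂ : ℝ) (μ : Measure (ℝ × ℝ)),
        0 ≤ b₁ ∧ 0 ≤ b₂ ∧ GrowthCondition μ ∧ NevanlinnaCondition μ ∧
        ∀ z ∈ polyUpperHalfPlane,
          q z = (a : ℂ) + (b₁ : ℂ) * z.1 + (b₂ : ℂ) * z.2 +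
            1 / (π : ℂ) ^ 2 * ∫ t : ℝ × ℝ, kernelK z t ∂μ := by
  have hopen : IsOpen polyUpperHalfPlane :=
    (isOpen_lt continuous_const (continuous_im.comp continuous_fst)).inter
      (isOpen_lt continuous_const (continuous_im.comp continuous_snd))
  set F : ℂ × ℂ → ℂ := fun w ↦ -I * q (cayleyInv w.1, cayleyInv w.2) with hFdef
  have hmem : ∀ w ∈ ball (0 : ℂ) 1 ×ˢ ball (0 : ℂ) 1,
      (cayleyInv w.1, cayleyInv w.2) ∈ polyUpperHalfPlane := fun w hw ↦
    ⟨cayleyInv_im_pos hw.1, cayleyInv_im_pos hw.2⟩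
  have hF : DifferentiableOn ℂ F (ball (0 : ℂ) 1 ×ˢ ball (0 : ℂ) 1) := by
    intro w hw
    refine DifferentiableAt.differentiableWithinAt (DifferentiableAt.const_mul ?_ _)
    refine DifferentiableAt.comp w ((hq.1 _ (hmem w hw)).differentiableAt
      (hopen.mem_nhds (hmem w hw))) (f := fun w : ℂ × ℂ ↦ (cayleyInv w.1, cayleyInv w.2)) ?_
    have h1 := one_sub_ne_zero_of_mem_ball hw.1
    have h2 := one_sub_ne_zero_of_mem_ball hw.2
    unfold cayleyInv
    fun_prop (disch := assumption)
  have hre : ∀ p ∈ ball (0 : ℂ) 1 ×ˢ ball (0 : ℂ) 1, 0 ≤ (F p).re := fun p hp ↦ by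
    simpa [hFdef] using hq.2 _ (hmem p hp)
  obtain ⟨ν, _, hν⟩ := exists_torus_measure hF hre
  have horth := fun w₁ h₁ w₂ h₂ ↦ (hν w₁ h₁ w₂ h₂).2
  -- Since `q = i F`, the constant `i Im F (0, 0)` becomes `-Im F (0, 0)`; the slopes are the masses
  -- of the circles at infinity.
  refine ⟨-(F (0, 0)).im, ν.real lineFst, ν.real lineSnd, planeMeasure ν, measureReal_nonneg,
    measureReal_nonneg, growthCondition_planeMeasure ν, fun z hz ↦ ?_, fun z hz ↦ ?_⟩
  · have h₁ := cayley_mem_ball hz.1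
    have h₂ := cayley_mem_ball hz.2
    have c1 := continuous_shiftedSzego h₁
    have c2 := continuous_shiftedSzego h₂
    change ∫ t, (nevanlinnaKernel z t).re ∂(planeMeasure ν) = 0
    rw [integral_planeMeasure]
    have h : ∀ t, planeWeight t • (nevanlinnaKernel z t).re
        = (4 * conj (cayley z.1) * cayley z.2 * (shiftedSzego (cayley z.1) (cayleyPlane t).1
          * conj (shiftedSzego (cayley z.2) (cayleyPlane t).2))).re := by
      intro t
      rw [← nevanlinnaKernel_eq hz, re_ofReal_mul, smul_eq_mul]
    simp only [h]
    rw [integral_comap_cayleyPlane ν (fun s ↦ (4 * conj (cayley z.1) * cayley z.2 *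
      (shiftedSzego (cayley z.1) s.1 * conj (shiftedSzego (cayley z.2) s.2))).re)]
    have hi := integral_re (𝕜 := ℂ) (Continuous.integrable_of_compactSpace
      (f := fun s : UnitCircle × UnitCircle ↦ 4 * conj (cayley z.1) * cayley z.2 *
        (shiftedSzego (cayley z.1) s.1 * conj (shiftedSzego (cayley z.2) s.2))) (by fun_prop)
      (ν.restrict (lineFst ∪ lineSnd)ᶜ))
    simp only [RCLike.re_eq_complex_re] at hi
    rw [hi, integral_const_mul, setIntegral_shiftedSzego_eq_zero horth h₁ h₂]
    simp
  · have h₁ := cayley_mem_ball hz.1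
    have h₂ := cayley_mem_ball hz.2
    have hqF : q z = I * F (cayley z.1, cayley z.2) := by
      simp only [hFdef, cayleyInv_cayley hz.1, cayleyInv_cayley hz.2]
      linear_combination (q z) * I_sq
    have hK : 1 / (π : ℂ) ^ 2 * ∫ t, kernelK z t ∂(planeMeasure ν)
        = I * ∫ s in (lineFst ∪ lineSnd)ᶜ,
          (2 * (szego (cayley z.1) s.1 * szego (cayley z.2) s.2) - 1) ∂ν := by
      rw [integral_planeMeasure, ← integral_comap_cayleyPlane, ← integral_const_mul]
      simp only [real_smul, kernelK_eq hz, integral_const_mul]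
      push_cast
      rw [← mul_assoc, one_div, inv_mul_cancel₀ (by simp [Real.pi_ne_zero]), one_mul]
    -- The contribution of a circle at infinity is the inverse Cayley transform, which gives back
    -- the coordinate itself.
    have hb : ∀ z : ℂ, 0 < z.im → I * (2 * (1 - cayley z)⁻¹ - 1) = z := by
      intro z hz
      have h := add_I_ne_zero hz
      have h1 : 1 - cayley z = 2 * I / (z + I) := by
        rw [cayley]; field_simp; ring
      rw [h1]
      field_simp
      ring
    rw [hqF, (hν _ h₁ _ h₂).1, integral_szego_eq horth h₁ h₂, hK]
    push_cast
    linear_combination ((F (0, 0)).im : ℂ) * I_sq + (ν.real lineFst : ℂ) * hb _ hz.1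
      + (ν.real lineSnd : ℂ) * hb _ hz.2

/-! ### Holomorphy and positivity of the transform of a torus measure -/

theorem norm_szego_le {r : ℝ} (hr : r < 1) {w : ℂ} (hw : ‖w‖ < r) (s : UnitCircle) :
    ‖szego w s‖ ≤ (1 - r)⁻¹ := by
  rw [szego, norm_inv]
  refine inv_anti₀ (sub_pos.2 hr) ?_
  have h := norm_sub_norm_le (1 : ℂ) (w * conj (s : ℂ))
  rw [norm_mul, norm_conj, UnitCircle.norm_coe, norm_one, mul_one] at h
  linarith

theorem hasDerivAt_szego {w : ℂ} (hw : w ∈ ball (0 : ℂ) 1) (s : UnitCircle) :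
    HasDerivAt (fun w ↦ szego w s) (conj (s : ℂ) * szego w s ^ 2) w := by
  have h := UnitCircle.one_sub_mul_conj_ne_zero hw s
  have h1 := ((((hasDerivAt_id w).mul_const (conj (s : ℂ))).const_sub 1)).inv h
  refine h1.congr_deriv ?_
  simp only [szego, id]
  field_simp

/-- The derivative of the product of two Szegő kernels. -/
noncomputable def szegoFDeriv (w : ℂ × ℂ) (s : UnitCircle × UnitCircle) : ℂ × ℂ →L[ℂ] ℂ :=
  (szego w.1 s.1 * (conj (s.2 : ℂ) * szego w.2 s.2 ^ 2)) • ContinuousLinearMap.snd ℂ ℂ ℂ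
    + (szego w.2 s.2 * (conj (s.1 : ℂ) * szego w.1 s.1 ^ 2)) • ContinuousLinearMap.fst ℂ ℂ ℂ

theorem hasFDerivAt_szego_mul {w : ℂ × ℂ} (hw : w ∈ ball (0 : ℂ) 1 ×ˢ ball (0 : ℂ) 1)
    (s : UnitCircle × UnitCircle) :
    HasFDerivAt (fun w : ℂ × ℂ ↦ szego w.1 s.1 * szego w.2 s.2) (szegoFDeriv w s) w := by
  have h1 := (hasDerivAt_szego hw.1 s.1).comp_hasFDerivAt w
    (hasFDerivAt_fst (𝕜 := ℂ) (E := ℂ) (F := ℂ))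
  have h2 := (hasDerivAt_szego hw.2 s.2).comp_hasFDerivAt w
    (hasFDerivAt_snd (𝕜 := ℂ) (E := ℂ) (F := ℂ))
  refine (h1.mul h2).congr_fderiv ?_
  simp only [szegoFDeriv, smul_smul, Function.comp_apply]

theorem norm_szegoFDeriv_le {r : ℝ} (hr : r < 1) {w : ℂ × ℂ}
    (hw : w ∈ ball (0 : ℂ) r ×ˢ ball (0 : ℂ) r) (s : UnitCircle × UnitCircle) :
    ‖szegoFDeriv w s‖ ≤ 2 * (1 - r)⁻¹ ^ 3 := by
  have h1 := norm_szego_le hr (mem_ball_zero_iff.1 hw.1) s.1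
  have h2 := norm_szego_le hr (mem_ball_zero_iff.1 hw.2) s.2
  have h0 : 0 ≤ (1 - r)⁻¹ := (norm_nonneg _).trans h1
  have key : ∀ (x y : ℂ) (t : UnitCircle) (L : ℂ × ℂ →L[ℂ] ℂ), ‖x‖ ≤ (1 - r)⁻¹ →
      ‖y‖ ≤ (1 - r)⁻¹ → ‖L‖ ≤ 1 → ‖(x * (conj (t : ℂ) * y ^ 2)) • L‖ ≤ (1 - r)⁻¹ ^ 3 := by
    intro x y t L hx hy hL
    rw [norm_smul, norm_mul, norm_mul, norm_conj, UnitCircle.norm_coe, one_mul, norm_pow]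
    calc ‖x‖ * ‖y‖ ^ 2 * ‖L‖ ≤ (1 - r)⁻¹ * (1 - r)⁻¹ ^ 2 * 1 := by gcongr
      _ = (1 - r)⁻¹ ^ 3 := by ring
  refine (norm_add_le _ _).trans ?_
  rw [two_mul]
  exact add_le_add (key _ _ _ _ h1 h2 (ContinuousLinearMap.norm_snd_le ℂ ℂ ℂ))
    (key _ _ _ _ h2 h1 (ContinuousLinearMap.norm_fst_le ℂ ℂ ℂ))

/-- The function on the bidisc represented by a measure on the torus. -/
noncomputable def torusTransform (τ : Measure (UnitCircle × UnitCircle)) (w : ℂ × ℂ) : ℂ :=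
  ∫ s, (2 * (szego w.1 s.1 * szego w.2 s.2) - 1) ∂τ

section TorusTransform

variable {τ : Measure (UnitCircle × UnitCircle)} [IsFiniteMeasure τ]

theorem differentiableAt_torusTransform {w : ℂ × ℂ}
    (hw : w ∈ ball (0 : ℂ) 1 ×ˢ ball (0 : ℂ) 1) :
    DifferentiableAt ℂ (torusTransform τ) w := by
  -- A radius strictly between `w` and the boundary gives a neighbourhood on which the derivative is
  -- bounded uniformly in `s`.
  obtain ⟨r, hwr, hr⟩ : ∃ r, max ‖w.1‖ ‖w.2‖ < r ∧ r < 1 :=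
    exists_between (max_lt (mem_ball_zero_iff.1 hw.1) (mem_ball_zero_iff.1 hw.2))
  have hmem : w ∈ ball (0 : ℂ) r ×ˢ ball (0 : ℂ) r :=
    ⟨mem_ball_zero_iff.2 ((le_max_left _ _).trans_lt hwr),
      mem_ball_zero_iff.2 ((le_max_right _ _).trans_lt hwr)⟩
  have hsub : ball (0 : ℂ) r ×ˢ ball (0 : ℂ) r ⊆ ball (0 : ℂ) 1 ×ˢ ball (0 : ℂ) 1 :=
    prod_mono (ball_subset_ball hr.le) (ball_subset_ball hr.le)
  have hcont : ∀ v ∈ ball (0 : ℂ) 1 ×ˢ ball (0 : ℂ) 1,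
      Continuous fun s : UnitCircle × UnitCircle ↦ 2 * (szego v.1 s.1 * szego v.2 s.2) - 1 := by
    intro v hv
    have c1 := continuous_szego hv.1
    have c2 := continuous_szego hv.2
    fun_prop
  have hnhds : ball (0 : ℂ) r ×ˢ ball (0 : ℂ) r ∈ 𝓝 w :=
    (isOpen_ball.prod isOpen_ball).mem_nhds hmem
  have c1 := continuous_szego hw.1
  have c2 := continuous_szego hw.2
  refine (hasFDerivAt_integral_of_dominated_of_fderiv_le (𝕜 := ℂ) (μ := τ)
    (F := fun v s ↦ 2 * (szego v.1 s.1 * szego v.2 s.2) - 1)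
    (F' := fun v s ↦ (2 : ℂ) • szegoFDeriv v s)
    (bound := fun _ ↦ 2 * (2 * (1 - r)⁻¹ ^ 3)) hnhds ?_ ?_ ?_ ?_ ?_ ?_).differentiableAt
  · filter_upwards [hnhds] with v hv
    exact (hcont v (hsub hv)).aestronglyMeasurable
  · exact (hcont w hw).integrable_of_compactSpace τ
  · refine Continuous.aestronglyMeasurable ?_
    unfold szegoFDeriv
    fun_prop
  · refine .of_forall fun s v hv ↦ ?_
    rw [norm_smul, Complex.norm_ofNat]
    exact mul_le_mul_of_nonneg_left (norm_szegoFDeriv_le hr hv s) zero_le_two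
  · exact integrable_const _
  · exact .of_forall fun s v hv ↦ ((hasFDerivAt_szego_mul (hsub hv) s).const_mul 2).sub_const 1

/-- This is the Poisson kernel `(1 - |u|²) / |1 - u|²` with `u = w conj s`. -/
theorem one_add_two_mul_re_nonneg {w : ℂ} (hw : w ∈ ball (0 : ℂ) 1) (s : UnitCircle) :
    0 ≤ 1 + 2 * (w * conj (shiftedSzego w s)).re := by
  have h := UnitCircle.one_sub_mul_conj_ne_zero hw s
  set u := w * conj (s : ℂ) with hu
  have hu1 : ‖u‖ < 1 := by
    rw [hu, norm_mul, norm_conj, UnitCircle.norm_coe, mul_one]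
    exact mem_ball_zero_iff.1 hw
  have hx : w * conj (shiftedSzego w s) = u / (1 - u) := by
    simp only [shiftedSzego, map_mul, map_inv₀, map_sub, map_one, conj_conj, ← hu]
    rw [← mul_assoc, ← hu, div_eq_mul_inv]
  have hn : 0 < normSq (1 - u) := normSq_pos.2 h
  have h2 : normSq u < 1 := by
    rw [normSq_eq_norm_sq]
    nlinarith [norm_nonneg u]
  have h3 : 1 + 2 * (u / (1 - u)).re = (1 - normSq u) / normSq (1 - u) := by
    rw [eq_div_iff hn.ne', div_re]
    field_simp
    simp only [normSq_apply, sub_re, one_re, sub_im, one_im]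
    ring
  rw [hx, h3]
  exact div_nonneg (by linarith) hn.le

theorem re_torusTransform_nonneg {w₁ w₂ : ℂ} (h₁ : w₁ ∈ ball (0 : ℂ) 1)
    (h₂ : w₂ ∈ ball (0 : ℂ) 1)
    (hτ : ∫ s, (4 * conj w₁ * w₂ * (shiftedSzego w₁ s.1 * conj (shiftedSzego w₂ s.2))).re ∂τ = 0) :
    0 ≤ (torusTransform τ (w₁, w₂)).re := by
  have c1 := continuous_szego h₁
  have c2 := continuous_szego h₂
  have d1 := continuous_shiftedSzego h₁
  have d2 := continuous_shiftedSzego h₂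
  have hi := integral_re (𝕜 := ℂ) (Continuous.integrable_of_compactSpace
    (f := fun s : UnitCircle × UnitCircle ↦ 2 * (szego w₁ s.1 * szego w₂ s.2) - 1)
    (by fun_prop) τ)
  simp only [RCLike.re_eq_complex_re] at hi
  -- With `x = S₁ - 1` and `y = S₂ - 1`, one has `(1 + 2 Re x) (1 + 2 Re y) = Re (2 (1 + x) (1 + y)
  -- - 1) + 2 Re (conj x * y)`. The added term is the last one; its integral is zero by `hτ`.
  have hsum := integral_add (μ := τ)
    (f := fun s ↦ (2 * (szego w₁ s.1 * szego w₂ s.2) - 1).re)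
    (g := fun s ↦ 1 / 2 *
      (4 * conj w₁ * w₂ * (shiftedSzego w₁ s.1 * conj (shiftedSzego w₂ s.2))).re)
    ((continuous_re.comp (by fun_prop)).integrable_of_compactSpace τ)
    (((continuous_re.comp (by fun_prop)).integrable_of_compactSpace τ).const_mul _)
  rw [integral_const_mul, hτ, mul_zero, add_zero, hi] at hsum
  rw [torusTransform, ← hsum]
  refine integral_nonneg fun s ↦ ?_
  have e1 := one_add_two_mul_re_nonneg h₁ s.1
  have e2 := one_add_two_mul_re_nonneg h₂ s.2
  have e3 : 4 * conj w₁ * w₂ * (shiftedSzego w₁ s.1 * conj (shiftedSzego w₂ s.2))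
      = 4 * (conj (w₁ * conj (shiftedSzego w₁ s.1)) * (w₂ * conj (shiftedSzego w₂ s.2))) := by
    simp only [map_mul, conj_conj]
    ring
  simp only [e3, szego_eq_one_add h₁, szego_eq_one_add h₂]
  generalize w₁ * conj (shiftedSzego w₁ s.1) = x at *
  generalize w₂ * conj (shiftedSzego w₂ s.2) = y at *
  refine (mul_nonneg e1 e2).trans_eq ?_
  simp
  ring

end TorusTransform

/-! ### From a representation to a Herglotz-Nevanlinna function -/

/-- The measure on the torus that corresponds to a measure on the plane. -/
noncomputable def torusMeasure (μ : Measure (ℝ × ℝ)) : Measure (UnitCircle × UnitCircle) :=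
  (μ.withDensity fun t ↦ ENNReal.ofReal (1 / planeWeight t)).map cayleyPlane

/-- The growth condition says precisely that the weighted measure has finite mass. -/
theorem isFiniteMeasure_torusMeasure {μ : Measure (ℝ × ℝ)} (hμ : GrowthCondition μ) :
    IsFiniteMeasure (torusMeasure μ) := by
  have : IsFiniteMeasure (μ.withDensity fun t ↦ ENNReal.ofReal (1 / planeWeight t)) :=
    isFiniteMeasure_withDensity hμ.ne
  exact Measure.isFiniteMeasure_map _ _

theorem integral_torusMeasure (μ : Measure (ℝ × ℝ)) {E : Type*} [NormedAddCommGroup E]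
    [NormedSpace ℝ E] {k : UnitCircle × UnitCircle → E} {f : ℝ × ℝ → E}
    (h : ∀ t, planeWeight t • f t = k (cayleyPlane t)) :
    ∫ s, k s ∂(torusMeasure μ) = ∫ t, f t ∂μ := by
  have c : Measurable fun t ↦ ENNReal.ofReal (1 / planeWeight t) :=
    (measurable_const.div continuous_planeWeight.measurable).ennreal_ofReal
  rw [torusMeasure, measurableEmbedding_cayleyPlane.integral_map,
    integral_withDensity_eq_integral_toReal_smul c (.of_forall fun _ ↦ ENNReal.ofReal_lt_top)]
  congr! 2 with t
  have := planeWeight_pos t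
  rw [ENNReal.toReal_ofReal (by positivity), ← h, smul_smul, one_div_mul_cancel this.ne', one_smul]

theorem isHerglotzNevanlinna_of_representation {q : ℂ × ℂ → ℂ} {a b₁ b₂ : ℝ}
    {μ : Measure (ℝ × ℝ)} (hb₁ : 0 ≤ b₁) (hb₂ : 0 ≤ b₂) (hμ : GrowthCondition μ)
    (hN : NevanlinnaCondition μ)
    (hq : ∀ z ∈ polyUpperHalfPlane,
      q z = (a : ℂ) + (b₁ : ℂ) * z.1 + (b₂ : ℂ) * z.2 +
        1 / (π : ℂ) ^ 2 * ∫ t : ℝ × ℝ, kernelK z t ∂μ) :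
    IsHerglotzNevanlinna q := by
  have := isFiniteMeasure_torusMeasure hμ
  have hball : ∀ z ∈ polyUpperHalfPlane,
      (cayley z.1, cayley z.2) ∈ ball (0 : ℂ) 1 ×ˢ ball (0 : ℂ) 1 := fun z hz ↦
    ⟨cayley_mem_ball hz.1, cayley_mem_ball hz.2⟩
  have hK : ∀ z ∈ polyUpperHalfPlane, ∫ t, kernelK z t ∂μ
      = I * torusTransform (torusMeasure μ) (cayley z.1, cayley z.2) := by
    intro z hz
    rw [torusTransform, ← integral_const_mul]
    exact (integral_torusMeasure μ fun t ↦ by rw [real_smul, kernelK_eq hz]).symm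
  constructor
  · have hd : DifferentiableOn ℂ (fun z : ℂ × ℂ ↦ (a : ℂ) + (b₁ : ℂ) * z.1 + (b₂ : ℂ) * z.2 +
        1 / (π : ℂ) ^ 2 * (I * torusTransform (torusMeasure μ) (cayley z.1, cayley z.2)))
        polyUpperHalfPlane := by
      intro z hz
      refine DifferentiableAt.differentiableWithinAt ?_
      have h1 := add_I_ne_zero hz.1
      have h2 := add_I_ne_zero hz.2
      have hc : DifferentiableAt ℂ (fun z : ℂ × ℂ ↦ (cayley z.1, cayley z.2)) z := by
        unfold cayley
        fun_prop (disch := assumption)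
      have ht := DifferentiableAt.comp z
        (differentiableAt_torusTransform (τ := torusMeasure μ) (hball z hz)) hc
      exact DifferentiableAt.add (by fun_prop) ((ht.const_mul I).const_mul _)
    exact hd.congr fun z hz ↦ by rw [hq z hz, hK z hz]
  · intro z hz
    have hre : 0 ≤ (torusTransform (torusMeasure μ) (cayley z.1, cayley z.2)).re := by
      refine re_torusTransform_nonneg (hball z hz).1 (hball z hz).2 ?_
      rw [← hN z hz]
      exact integral_torusMeasure μ fun t ↦ by
        rw [← nevanlinnaKernel_eq hz, re_ofReal_mul, smul_eq_mul, nevanlinnaKernel]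
    have h1 : (1 / (π : ℂ) ^ 2) = ((1 / π ^ 2 : ℝ) : ℂ) := by push_cast; rfl
    rw [hq z hz, hK z hz, h1, add_im, im_ofReal_mul, I_mul_im]
    simp only [add_im, ofReal_im, im_ofReal_mul, zero_add]
    have := hz.1.le
    have := hz.2.le
    positivity

theorem mainTheorem1 (q : ℂ × ℂ → ℂ) :
    IsHerglotzNevanlinna q ↔
      ∃ (a b₁ b₂ : ℝ) (μ : Measure (ℝ × ℝ)),
        0 ≤ b₁ ∧ 0 ≤ b₂ ∧ GrowthCondition μ ∧ NevanlinnaCondition μ ∧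
        ∀ z ∈ polyUpperHalfPlane,
          q z = (a : ℂ) + (b₁ : ℂ) * z.1 + (b₂ : ℂ) * z.2 +
            1 / (Real.pi : ℂ) ^ 2 * ∫ t : ℝ × ℝ, kernelK z t ∂μ := by
  refine ⟨exists_representation, ?_⟩
  rintro ⟨a, b₁, b₂, μ, hb₁, hb₂, hμ, hN, hq⟩
  exact isHerglotzNevanlinna_of_representation hb₁ hb₂ hμ hN hq
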